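/- Let $d\in\mathbb N$ and $T>0$. For a vector field $b$ on $\mathbb{R}^d\times[0,T]$ and a nonnegative finite Borel measure $\nu$ on $\mathbb{R}^d$, a family $(\mu_t)_{t\in[0,T]}$ of nonnegative locally bounded Borel measures on $\mathbb{R}^d$ is called a solution of the Cauchy problem $$\partial_t\mu+\operatorname{div}(b\mu)=0,\qquad \mu|_{t=0}=\nu, \tag{1}$$ if $t\mapsto\mu_t(B)$ is measurable for every bounded Borel set $B$, $t\mapsto\mu_t(K)$ is in $L^1[0,T]$ for every compact $K\subset\mathbb{R}^d$, $b$ is integrable on $U\times[0,T]$ with respect to the locally bounded measure $\mu=\mu_t(dx)\,dt$ for every ball $U\subset\mathbb{R}^d$ (the relation $\mu=\mu_t(dx)\,dt$ meaning that $\int u\,d\mu=\int_0^T\int_{\mathbb{R}^d}u(x,t)\,\mu_t(dx)\,dt$ for all $u\in C_0^\infty(\mathbb{R}^d\times(0,T))$), and for every real function $u$ that is continuous on $\mathbb{R}^d\times[0,T)$ along with its first order derivatives in $t$ and $x$ and satisfies $u(x,t)=0$ for $|x|>R$ for some $R$, one has $$\int_{\mathbb{R}^d}u(x,t)\,\mu_t(dx)=\int_{\mathbb{R}^d}u(x,0)\,\nu(dx)+\int_0^t\int_{\mathbb{R}^d}\bigl[\partial_tu+\langle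 b,\nabla u\rangle\bigr]\,\mu_s(dx)\,ds$$ for almost every $t\in[0,T]$. Proposition 1. Assume that $b\colon\mathbb{R}^d\times[0,T]\to\mathbb{R}^d$ is continuous. Suppose that there exist a sequence of vector fields $b_k\in C^\infty(\mathbb{R}^d\times\mathbb{R}^1,\mathbb{R}^d)$ and a sequence of positive functions $V_k\in C^1(\mathbb{R}^d)$ such that (i) there exist real numbers $C_1,C_2,C_3$ such that $V_k\le C_1V_m+C_2$ on $\mathbb{R}^d$ whenever $k\le m$, and $$\langle b_k(x,t),\nabla V_k(x)\rangle\le C_3V_k(x)\qquad\text{for all } k \text{ and all } (x,t)\in\mathbb{R}^d\times[0,T];$$ (ii) for every $k$ the function $(1+|x|)^{-1}|b_k(x,t)|$ is bounded on $\mathbb{R}^d\times[0,T]$, and $b_k\to b$ uniformly on $U\times[0,T]$ for every ball $U\subset\mathbb{R}^d$. Then, for every nonnegative finite Borel measure $\nu$ on $\mathbb{R}^d$ such that $\sup_k\|V_k\|_{L^1(\nu)}<\infty$, there exists a family of nonnegative finite measures $(\mu_t)_{t\in[0,T]}$ solving the Cauchy problem (1) and such that for every ball $U\subset\mathbb{R}^d$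 $$\lim_{k\to\infty}\int_0^T\int_U|b-b_k|\sqrt{V_k}\,d\mu_t\,dt=0.$$ -/

import Mathlib

open MeasureTheory Set Filter Topology
open scoped ContDiff

/-- A nonnegative locally bounded Borel measure `M` on `ℝ^d × [0, T]` (realised as a measure on
`ℝ^d × ℝ` carried by the strip) is given by the family `(μ t)`, `t ∈ [0, T]`, of nonnegative
locally bounded Borel measures on `ℝ^d`. Values of `μ t` for `t ∉ [0, T]` play no role. -/
structure IsGivenByFamily {d : ℕ} (T : ℝ) (M : Measure (EuclideanSpace ℝ (Fin d) × ℝ))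
    (μ : ℝ → Measure (EuclideanSpace ℝ (Fin d))) : Prop where
  /-- `M` is carried by `ℝ^d × [0, T]`. -/
  carried : M ((univ ×ˢ Icc 0 T)ᶜ) = 0
  /-- `M` is locally bounded. -/
  locally_bounded : ∀ K : Set (EuclideanSpace ℝ (Fin d) × ℝ), IsCompact K → M K < ⊤
  /-- Every `μ t` is locally bounded. -/
  family_locally_bounded : ∀ t ∈ Icc (0 : ℝ) T, ∀ K : Set (EuclideanSpace ℝ (Fin d)),
    IsCompact K → μ t K < ⊤
  /-- `t ↦ μ t B` is measurable on `[0, T]` for bounded Borel sets `B`. -/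
  measurable : ∀ B : Set (EuclideanSpace ℝ (Fin d)), MeasurableSet B → Bornology.IsBounded B →
    Measurable (fun t : Icc (0 : ℝ) T => μ t B)
  /-- `t ↦ μ t K` is in `L¹[0, T]` for compact sets `K`. -/
  integrable : ∀ K : Set (EuclideanSpace ℝ (Fin d)), IsCompact K →
    (∫⁻ t in Icc (0 : ℝ) T, μ t K) < ⊤
  /-- `M (dx dt) = μ t (dx) dt`, tested on `C_0^∞(ℝ^d × (0, T))`. -/
  integral_eq : ∀ u : EuclideanSpace ℝ (Fin d) × ℝ → ℝ, ContDiff ℝ ∞ u → HasCompactSupport u →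
    tsupport u ⊆ univ ×ˢ Ioo 0 T →
    ∫ p, u p ∂M = ∫ t in Icc (0 : ℝ) T, ∫ x, u (x, t) ∂(μ t)

/-- `u` is a test function on `ℝ^d × [0, T)`: it is continuous there together with its first order
derivatives `ut` in `t` (one-sided at `t = 0`) and `ux` in `x` (the spatial gradient), and it
vanishes for `x` outside some ball. -/
structure IsTestFunction {d : ℕ} (T : ℝ) (u ut : EuclideanSpace ℝ (Fin d) × ℝ → ℝ)
    (ux : EuclideanSpace ℝ (Fin d) × ℝ → EuclideanSpace ℝ (Fin d)) : Prop where
  hasDeriv_time : ∀ x, ∀ t ∈ Ico (0 : ℝ) T,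
    HasDerivWithinAt (fun s => u (x, s)) (ut (x, t)) (Ico 0 T) t
  hasGradient_space : ∀ x, ∀ t ∈ Ico (0 : ℝ) T, HasGradientAt (fun y => u (y, t)) (ux (x, t)) x
  continuousOn : ContinuousOn u (univ ×ˢ Ico 0 T)
  continuousOn_time : ContinuousOn ut (univ ×ˢ Ico 0 T)
  continuousOn_space : ContinuousOn ux (univ ×ˢ Ico 0 T)
  vanishes : ∃ R : ℝ, ∀ x, R < ‖x‖ → ∀ t ∈ Ico (0 : ℝ) T, u (x, t) = 0

/-- The family `(μ t)`, `t ∈ [0, T]`, of nonnegative locally bounded Borel measures solves the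
Cauchy problem `∂ₜμ + div (b μ) = 0`, `μ|_{t = 0} = ν`: the measure `M = μ t (dx) dt` is locally
bounded, `b` is `M`-integrable on `U × [0, T]` for every ball `U`, and the integral identity
holds for every test function and almost every `t ∈ [0, T]`. -/
def IsSolution {d : ℕ} (T : ℝ) (b : EuclideanSpace ℝ (Fin d) × ℝ → EuclideanSpace ℝ (Fin d))
    (ν : Measure (EuclideanSpace ℝ (Fin d))) (μ : ℝ → Measure (EuclideanSpace ℝ (Fin d))) :
    Prop :=
  ∃ M : Measure (EuclideanSpace ℝ (Fin d) × ℝ), IsGivenByFamily T M μ ∧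
    (∀ (c : EuclideanSpace ℝ (Fin d)) (r : ℝ), IntegrableOn b (Metric.ball c r ×ˢ Icc 0 T) M) ∧
    ∀ (u ut : EuclideanSpace ℝ (Fin d) × ℝ → ℝ)
      (ux : EuclideanSpace ℝ (Fin d) × ℝ → EuclideanSpace ℝ (Fin d)), IsTestFunction T u ut ux →
      ∀ᵐ t ∂(volume.restrict (Icc (0 : ℝ) T)),
        ∫ x, u (x, t) ∂(μ t) = ∫ x, u (x, 0) ∂ν +
          ∫ s in (0 : ℝ)..t, ∫ x, (ut (x, s) + inner ℝ (b (x, s)) (ux (x, s))) ∂(μ s)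

/-! Solutions are built by transporting `ν` along flows and passing to a vague limit. Each `b_k` is
multiplied by a smooth cut-off equal to 1 on larger and larger balls. The resulting field `a_k` has
compact support, so it has a flow `Φ_k` on all of `[0, T]`, and the images of `ν` under `Φ_k(·, t)`
solve the equation for `a_k` by the chain rule along trajectories and Fubini (`integral_flow_eq`).
Their masses are at most `ν(ℝ^d)`, so for every `t` they converge vaguely along one and the same
ultrafilter, to `μ t`. Mass may escape to infinity, which is harmless since test functions vanish
outside a ball.

The limit of the equation needs control in time. The fields `a_k` are bounded on each ball uniformly
in `k`, so trajectories have a common modulus of continuity there (`exists_flow_modulus`). Integrals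
of functions vanishing outside a ball are therefore equicontinuous in time, and their convergence is
uniform on compact intervals. Replacing `a_k` by `b` in the drift costs an error controlled by the
locally uniform convergence of the fields (`integral_limit_eq`).

For the last claim, `V_k` grows along trajectories of `a_k` at most by the factor `e^{|C₃|T}`
(`lyapunov_flow_le`). For `k ≥ n` one has `√V_n ≤ 1 + V_n ≤ 1 + |C₂| + |C₁| V_k`, so integrals
against `μ t` of compactly supported `f ≤ √V_n` are bounded by a constant independent of `n` and
`t`. The integral in question is then at most this constant times `T sup |b - b_k|`, the supremum
being over `U × [0, T]`. -/

open scoped NNReal ENNReal CompactlySupported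

/-! ### Vague limits and measurable families of measures -/

/-- Along an ultrafilter, measures of uniformly bounded mass converge vaguely. -/
theorem exists_measure_tendsto_integral {X : Type*} [TopologicalSpace X] [T2Space X]
    [LocallyCompactSpace X] [MeasurableSpace X] [BorelSpace X] {ι : Type*} (l : Ultrafilter ι)
    (m : ι → Measure X) {C : ℝ≥0} (hm : ∀ i, m i univ ≤ C) :
    ∃ μ : Measure X, μ univ ≤ C ∧
      ∀ f : C_c(X, ℝ), Tendsto (fun i => ∫ x, f x ∂(m i)) l (𝓝 (∫ x, f x ∂μ)) := by
  have hfin : ∀ i, IsFiniteMeasure (m i) := fun i => ⟨(hm i).trans_lt ENNReal.coe_lt_top⟩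
  have hbound : ∀ (f : C_c(X, ℝ)) (B : ℝ), (∀ x, ‖f x‖ ≤ B) → 0 ≤ B →
      ∀ i, ‖∫ x, f x ∂(m i)‖ ≤ B * C := by
    intro f B hB hB0 i
    refine (norm_integral_le_of_norm_le_const (.of_forall hB)).trans ?_
    refine mul_le_mul_of_nonneg_left ?_ hB0
    exact ENNReal.toReal_le_coe_of_le_coe (hm i)
  have hex : ∀ f : C_c(X, ℝ), ∃ L, Tendsto (fun i => ∫ x, f x ∂(m i)) l (𝓝 L) := by
    intro f
    obtain ⟨B, hB⟩ := f.hasCompactSupport.exists_bound_of_continuous f.continuous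
    have hB' : ∀ x, ‖f x‖ ≤ |B| := fun x => (hB x).trans (le_abs_self B)
    -- An ultrafilter on a compact interval converges, so every `f` gets its limit along the same
    -- `l` and no diagonal extraction is needed.
    obtain ⟨L, -, hL⟩ := (isCompact_closedBall (0 : ℝ) (|B| * C)).ultrafilter_le_nhds
      (l.map fun i => ∫ x, f x ∂(m i)) (by
        rw [le_principal_iff]
        refine Ultrafilter.mem_map.2 (Filter.mem_of_superset univ_mem fun i _ => ?_)
        simpa using hbound f _ hB' (abs_nonneg B) i)
    exact ⟨L, hL⟩
  choose L hL using hex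
  have hint : ∀ (f : C_c(X, ℝ)) i, Integrable (fun x => f x) (m i) := fun f i =>
    f.continuous.integrable_of_hasCompactSupport f.hasCompactSupport
  let Λ : C_c(X, ℝ) →ₚ[ℝ] ℝ := PositiveLinearMap.mk₀
    { toFun := L
      map_add' := fun f g => by
        refine tendsto_nhds_unique (hL (f + g)) (((hL f).add (hL g)).congr fun i => ?_)
        rw [← integral_add (hint f i) (hint g i)]; rfl
      map_smul' := fun c f => by
        refine tendsto_nhds_unique (hL (c • f)) (((hL f).const_mul c).congr fun i => ?_)
        rw [← integral_const_mul]; rfl }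
    (fun f hf => ge_of_tendsto' (hL f) fun i => integral_nonneg fun x => hf x)
  refine ⟨RealRMK.rieszMeasure Λ, ?_, fun f => ?_⟩
  -- Inner regularity on the open set `univ` reduces the mass bound to compact `K`, where a cut-off
  -- equal to 1 on `K` dominates the indicator.
  · rw [isOpen_univ.measure_eq_iSup_isCompact]
    refine iSup_le fun K => iSup_le fun _ => iSup_le fun hK => ?_
    obtain ⟨f, hf1, -, hfc, hf01⟩ := exists_continuous_one_zero_of_isCompact hK
      isClosed_empty (disjoint_empty K)
    let F : C_c(X, ℝ) := ⟨f, hfc⟩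
    have h1 : Λ F ≤ C := le_of_tendsto' (hL F) fun i => by
      have := (le_abs_self _).trans (hbound F 1 (fun x => by
        exact (abs_of_nonneg (hf01 x).1).trans_le (hf01 x).2) zero_le_one i)
      simpa using this
    refine (RealRMK.rieszMeasure_le_of_eq_one Λ (f := F) (fun x => (hf01 x).1)
      (K := K) hK (fun x hx => hf1 hx)).trans ?_
    rw [← ENNReal.ofReal_coe_nnreal]
    exact ENNReal.ofReal_le_ofReal h1
  · rw [RealRMK.integral_rieszMeasure]
    exact hL f

/-- A family of finite measures on a proper space is measurable as soon as the integrals of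
compactly supported continuous functions are. -/
theorem measurable_measure_of_integral {X : Type*} [MetricSpace X] [ProperSpace X]
    [MeasurableSpace X] [BorelSpace X] {α : Type*} [MeasurableSpace α] {μ : α → Measure X}
    [∀ a, IsFiniteMeasure (μ a)]
    (h : ∀ f : X → ℝ, Continuous f → HasCompactSupport f → Measurable fun a => ∫ x, f x ∂(μ a)) :
    Measurable μ := by
  have hcpt : ∀ K : Set X, IsCompact K → Measurable fun a => μ a K := by
    intro K hK
    let δ : ℕ → ℝ := fun n => 1 / ((n : ℝ) + 1)
    have hδ : ∀ n, 0 < δ n := fun n => Nat.one_div_pos_of_nat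
    -- Continuous approximations of the indicator of `K`; properness of the space makes their
    -- supports compact.
    let f : ℕ → X → ℝ := fun n x => (thickenedIndicator (hδ n) K x : ℝ)
    have hfc : ∀ n, Continuous (f n) := fun n =>
      NNReal.continuous_coe.comp (thickenedIndicator (hδ n) K).continuous
    have hfs : ∀ n, HasCompactSupport (f n) := fun n => by
      refine HasCompactSupport.intro (hK.cthickening (r := δ n)) fun x hx => ?_
      have := thickenedIndicator_zero (hδ n) K (x := x)
        (fun h' => hx (Metric.thickening_subset_cthickening _ _ h'))
      simp only [f, this, NNReal.coe_zero]
    have hlim : ∀ a, Tendsto (fun n => ENNReal.ofReal (∫ x, f n x ∂(μ a))) atTop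
        (𝓝 (μ a K)) := by
      intro a
      have := tendsto_lintegral_thickenedIndicator_of_isClosed (μ a) hK.isClosed hδ
        tendsto_one_div_add_atTop_nhds_zero_nat
      refine this.congr fun n => ?_
      rw [ofReal_integral_eq_lintegral_ofReal ((hfc n).integrable_of_hasCompactSupport (hfs n))
        (.of_forall fun x => NNReal.coe_nonneg _)]
      simp only [f, ENNReal.ofReal_coe_nnreal]
    exact measurable_of_tendsto_metrizable
      (fun n => ENNReal.measurable_ofReal.comp (h (f n) (hfc n) (hfs n)))
      (tendsto_pi_nhds.2 hlim)
  have hclosed : ∀ s : Set X, IsClosed s → Measurable fun a => μ a s := by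
    intro s hs
    have heq : ∀ a, μ a s = ⨆ n, μ a (compactCovering X n ∩ s) := fun a => by
      rw [← Monotone.measure_iUnion (fun i j hij => inter_subset_inter_left s
        (compactCovering_subset X hij)), ← iUnion_inter, iUnion_compactCovering, univ_inter]
    simp only [heq]
    exact Measurable.iSup fun n => hcpt _ ((isCompact_compactCovering X n).inter_right hs)
  exact Measurable.measure_of_isPiSystem
    (by rw [BorelSpace.measurable_eq (α := X), borel_eq_generateFrom_isClosed])
    isPiSystem_isClosed hclosed (hclosed _ isClosed_univ)

/-! ### Flows and their uniform moduli of continuity -/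

/-- A `C¹` compactly supported vector field has a continuous flow on `[0, T]`, constant in time
outside `[0, T]`. -/
theorem exists_flow {E : Type*} [NormedAddCommGroup E] [NormedSpace ℝ E] [FiniteDimensional ℝ E]
    {a : E × ℝ → E} (ha : ContDiff ℝ 1 a) (hc : HasCompactSupport a) {T : ℝ} (hT : 0 ≤ T) :
    ∃ Φ : E × ℝ → E, Continuous Φ ∧ (∀ x, Φ (x, 0) = x) ∧
      (∀ x t, Φ (x, t) = Φ (x, projIcc 0 T hT t)) ∧
      ∀ x, ∀ t ∈ Icc 0 T,
        HasDerivWithinAt (fun s => Φ (x, s)) (a (Φ (x, t), t)) (Icc 0 T) t := by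
  obtain ⟨K, hK⟩ := ContDiff.lipschitzWith_of_hasCompactSupport (𝕂 := ℝ) hc ha one_ne_zero
  obtain ⟨L, hL⟩ := hc.exists_bound_of_continuous ha.continuous
  have hKt : ∀ t, LipschitzWith K fun x => a (x, t) := fun t => by
    simpa [Function.comp_def] using hK.comp (LipschitzWith.prodMk_right t)
  have hex : ∀ x, ∃ α : ℝ → E, α 0 = x ∧
      ∀ t ∈ Icc 0 T, HasDerivWithinAt α (a (α t, t)) (Icc 0 T) t := by
    intro x
    -- The field is bounded by `L` everywhere, so the ball of radius `L * T` cannot be left and one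
    -- application covers all of `[0, T]`; the radius 0 fixes a single initial point.
    have hp : IsPicardLindelof (fun t x => a (x, t)) (⟨0, left_mem_Icc.2 hT⟩ : Icc 0 T) x
        (Real.toNNReal L * Real.toNNReal T) 0 (Real.toNNReal L) K :=
      { lipschitzOnWith := fun t _ => (hKt t).lipschitzOnWith
        continuousOn := fun x _ => by
          have := ha.continuous
          fun_prop
        norm_le := fun t _ x _ => (hL _).trans (Real.le_coe_toNNReal L)
        mul_max_le := by simp [hT] }
    exact hp.exists_eq_forall_mem_Icc_hasDerivWithinAt₀
  choose α hα0 hα using hex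
  have hαc : ∀ x, ContinuousOn (α x) (Icc 0 T) := fun x t ht => (hα x t ht).continuousWithinAt
  have hαr : ∀ x, ∀ t ∈ Ico 0 T, HasDerivWithinAt (α x) (a (α x t, t)) (Ici t) t := fun x t ht =>
    (hα x t (Ico_subset_Icc_self ht)).mono_of_mem_nhdsWithin
      (Icc_mem_nhdsGE_of_mem ht)
  refine ⟨fun p => α p.1 (projIcc 0 T hT p.2), ?_, fun x => ?_, fun x t => ?_, fun x t ht => ?_⟩
  -- Joint continuity: continuity in time plus the Grönwall Lipschitz bound in `x`, uniform in time.
  · refine continuous_prod_of_continuous_lipschitzWith _ (Real.toNNReal (Real.exp (K * T)))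
      (fun x => ?_) fun t => LipschitzWith.of_dist_le_mul fun x y => ?_
    · exact ((hαc x).domRestrict).comp continuous_projIcc
    · have ht := (projIcc 0 T hT t).2
      refine (dist_le_of_trajectories_ODE (v := fun t x => a (x, t)) hKt (hαc x) (hαr x)
        (hαc y) (hαr y) le_rfl _ ht).trans ?_
      rw [hα0, hα0, mul_comm, Real.coe_toNNReal _ (Real.exp_nonneg _)]
      gcongr
      simpa using ht.2
  · simp [projIcc_left, hα0]
  · simp
  · have h : ∀ s ∈ Icc 0 T, α x (projIcc 0 T hT s) = α x s := fun s hs => by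
      rw [projIcc_of_mem hT hs]
    simp only [h t ht]
    exact (hα x t ht).congr_of_mem h ht

/-- A quantity that grows at rate at most `C` along a vector field grows at most exponentially
along its integral curves. -/
theorem le_exp_mul_of_hasDerivWithinAt {T C : ℝ} {h h' : ℝ → ℝ}
    (hh : ∀ t ∈ Icc 0 T, HasDerivWithinAt h (h' t) (Icc 0 T) t)
    (hC : ∀ t ∈ Icc 0 T, h' t ≤ C * h t) {t : ℝ} (ht : t ∈ Icc 0 T) :
    h t ≤ Real.exp (C * t) * h 0 := by
  have hd : ∀ t ∈ Icc 0 T, HasDerivWithinAt (fun t => Real.exp (-(C * t)) * h t)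
      (Real.exp (-(C * t)) * (h' t - C * h t)) (Icc 0 T) t := fun t ht => by
    have h1 : HasDerivAt (fun t => Real.exp (-(C * t))) (Real.exp (-(C * t)) * -(C * 1)) t :=
      ((hasDerivAt_id t).const_mul C).neg.exp
    refine (h1.hasDerivWithinAt.mul (hh t ht)).congr_deriv ?_
    ring
  have hanti : AntitoneOn (fun t => Real.exp (-(C * t)) * h t) (Icc 0 T) := by
    refine antitoneOn_of_hasDerivWithinAt_nonpos (convex_Icc 0 T)
      (fun t ht => (hd t ht).continuousWithinAt)
      (fun t ht => (hd t (interior_subset ht)).mono interior_subset) fun t ht => ?_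
    exact mul_nonpos_of_nonneg_of_nonpos (Real.exp_nonneg _)
      (sub_nonpos.2 (hC t (interior_subset ht)))
  have := hanti (left_mem_Icc.2 (ht.1.trans ht.2)) ht ht.1
  simp only [mul_zero, neg_zero, Real.exp_zero, one_mul] at this
  calc h t = Real.exp (C * t) * (Real.exp (-(C * t)) * h t) := by
        rw [← mul_assoc, ← Real.exp_add]; simp
    _ ≤ _ := by gcongr

/-- A curve starting in the ball of radius `R` moves at speed at most `M` as long as it stays in
the ball of radius `R + ε`, if its velocity is less than `M` there. -/
theorem norm_sub_le_of_speed_lt_right {E : Type*} [NormedAddCommGroup E] [NormedSpace ℝ E]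
    {γ γ' : ℝ → E} {s e M R ε : ℝ} (hse : s ≤ e) (hγ : ContinuousOn γ (Icc s e))
    (hγ' : ∀ t ∈ Ico s e, HasDerivWithinAt γ (γ' t) (Ici t) t)
    (hM : ∀ t ∈ Ico s e, ‖γ t‖ ≤ R + ε → ‖γ' t‖ < M) (hM0 : 0 ≤ M) (hs : ‖γ s‖ ≤ R)
    (h : M * (e - s) ≤ ε) : ‖γ e - γ s‖ ≤ M * (e - s) := by
  -- Barrier argument: wherever the displacement touches `M * (t - s)`, the curve is still within
  -- radius `R + ε`, so its speed is strictly below the slope `M`.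
  refine image_norm_le_of_norm_deriv_right_lt_deriv_boundary (f := fun t => γ t - γ s) (f' := γ')
    (B := fun t => M * (t - s)) (B' := fun _ => M) (hγ.sub continuousOn_const)
    (fun t ht => (hγ' t ht).sub_const _) (by simp)
    (fun t => by simpa using ((hasDerivAt_id t).sub_const s).const_mul M)
    (fun t ht heq => hM t ht ?_) (right_mem_Icc.2 hse)
  have h1 : M * (t - s) ≤ M * (e - s) := by
    have := ht.2.le
    gcongr
  have h2 := norm_add_le (γ s) (γ t - γ s)
  rw [add_sub_cancel] at h2
  linarith

/-- The backward direction is the forward one for the time-reversed curve. Both are needed because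
either of two times may be the one at which the curve is known to lie in the ball. -/
theorem norm_sub_le_of_speed_lt {E : Type*} [NormedAddCommGroup E] [NormedSpace ℝ E]
    {γ γ' : ℝ → E} {T M R ε s e : ℝ}
    (hγ : ∀ t ∈ Icc 0 T, HasDerivWithinAt γ (γ' t) (Icc 0 T) t)
    (hM : ∀ t ∈ Icc 0 T, ‖γ t‖ ≤ R + ε → ‖γ' t‖ < M) (hM0 : 0 ≤ M) (hs0 : s ∈ Icc 0 T)
    (he0 : e ∈ Icc 0 T) (hs : ‖γ s‖ ≤ R) (h : M * |e - s| ≤ ε) :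
    ‖γ e - γ s‖ ≤ M * |e - s| := by
  have hc : ContinuousOn γ (Icc 0 T) := fun t ht => (hγ t ht).continuousWithinAt
  rcases le_total s e with hse | hes
  · rw [abs_of_nonneg (sub_nonneg.2 hse)] at h ⊢
    refine norm_sub_le_of_speed_lt_right hse (hc.mono (Icc_subset_Icc hs0.1 he0.2))
      (fun t ht => ?_) (fun t ht => hM t ⟨hs0.1.trans ht.1, ht.2.le.trans he0.2⟩) hM0 hs h
    exact (hγ t ⟨hs0.1.trans ht.1, ht.2.le.trans he0.2⟩).mono_of_mem_nhdsWithin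
      (Icc_mem_nhdsGE_of_mem ⟨hs0.1.trans ht.1, ht.2.trans_le he0.2⟩)
  · rw [abs_of_nonpos (sub_nonpos.2 hes)] at h ⊢
    have hneg : -(e - s) = -e - -s := by ring
    rw [hneg] at h ⊢
    have hmem : ∀ t ∈ Ico (-s) (-e), -t ∈ Ioc 0 T := fun t ht =>
      ⟨by linarith [ht.2, he0.1], by linarith [ht.1, hs0.2]⟩
    have := norm_sub_le_of_speed_lt_right (γ := fun t => γ (-t)) (γ' := fun t => -γ' (-t))
      (R := R) (neg_le_neg hes) (hc.comp continuousOn_neg fun t ht =>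
        ⟨by linarith [ht.2, he0.1], by linarith [ht.1, hs0.2]⟩)
      (fun t ht => ?_)
      (fun t ht => by rw [norm_neg]; exact hM _ (Ioc_subset_Icc_self (hmem t ht)))
      hM0 (by simpa using hs) h
    · simpa using this
    · have h1 : HasDerivWithinAt γ (γ' (-t)) (Iic (-t)) (-t) :=
        (hγ (-t) (Ioc_subset_Icc_self (hmem t ht))).mono_of_mem_nhdsWithin
          (Icc_mem_nhdsLE_of_mem (hmem t ht))
      have hmaps : MapsTo Neg.neg (Ici t) (Iic (-t)) := fun x hx => neg_le_neg (mem_Ici.1 hx)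
      have := h1.scomp t (hasDerivAt_neg t).hasDerivWithinAt hmaps
      simpa only [Function.comp_def, neg_smul, one_smul] using this

/-- Integral curves of a family of vector fields that is bounded, uniformly in the family, on
`closedBall 0 R × [0, T]` for every `R` are locally equicontinuous. -/
theorem exists_flow_modulus {E : Type*} [NormedAddCommGroup E] [NormedSpace ℝ E] {ι : Type*}
    {a Φ : ι → E × ℝ → E} {T : ℝ} (hT : 0 ≤ T)
    (hΦp : ∀ i x t, Φ i (x, t) = Φ i (x, projIcc 0 T hT t))
    (hΦ : ∀ i x, ∀ t ∈ Icc 0 T,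
      HasDerivWithinAt (fun s => Φ i (x, s)) (a i (Φ i (x, t), t)) (Icc 0 T) t)
    (ha : ∀ R : ℝ, ∃ M : ℝ, ∀ i x, ‖x‖ ≤ R → ∀ t ∈ Icc 0 T, ‖a i (x, t)‖ ≤ M)
    (R : ℝ) {ε : ℝ} (hε : 0 < ε) :
    ∃ δ > 0, ∀ i x s e, |e - s| < δ → ‖Φ i (x, s)‖ ≤ R → ‖Φ i (x, e) - Φ i (x, s)‖ < ε := by
  obtain ⟨M, hM⟩ := ha (R + ε)
  have hM0 : 0 < |M| + 1 := by positivity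
  refine ⟨ε / (|M| + 1), by positivity, fun i x s e hse hs => ?_⟩
  rw [hΦp i x s] at hs ⊢
  rw [hΦp i x e]
  have hproj : |(projIcc 0 T hT e : ℝ) - projIcc 0 T hT s| ≤ |e - s| := abs_projIcc_sub_projIcc hT
  have h1 : (|M| + 1) * |(projIcc 0 T hT e : ℝ) - projIcc 0 T hT s| < ε := by
    rw [← lt_div_iff₀' hM0]
    exact hproj.trans_lt hse
  refine (norm_sub_le_of_speed_lt (hΦ i x) (fun t ht hle => ?_) hM0.le (projIcc 0 T hT s).2
    (projIcc 0 T hT e).2 hs h1.le).trans_lt h1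
  have := (hM i _ hle t ht).trans (le_abs_self M)
  linarith

/-- If a trajectory is in the ball of radius `R` at one of the two times, the common modulus bounds
its displacement; if it is outside at both, `g` vanishes at both. The change of `g` is thus
uniformly small, and `ν` is finite. -/
theorem uniformEquicontinuous_integral_flow {E : Type*} [NormedAddCommGroup E]
    [MeasurableSpace E] [BorelSpace E] [SecondCountableTopology E] {ι : Type*} {Φ : ι → E × ℝ → E}
    (hc : ∀ i, Continuous (Φ i))
    (hΦ : ∀ R ε : ℝ, 0 < ε → ∃ δ > 0, ∀ i x s e, |e - s| < δ → ‖Φ i (x, s)‖ ≤ R →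
      ‖Φ i (x, e) - Φ i (x, s)‖ < ε)
    (ν : Measure E) [IsFiniteMeasure ν] {g : E × ℝ → ℝ} (hg : UniformContinuous g)
    {B : ℝ} (hB : ∀ p, ‖g p‖ ≤ B) {R : ℝ} (hR : ∀ x t, R < ‖x‖ → g (x, t) = 0) :
    UniformEquicontinuous fun i s => ∫ x, g (Φ i (x, s), s) ∂ν := by
  rw [Metric.uniformEquicontinuous_iff]
  intro ε hε
  have hν : 0 < ν.real univ + 1 := by positivity
  obtain ⟨η, hη, hgη⟩ := Metric.uniformContinuous_iff.1 hg (ε / (ν.real univ + 1)) (by positivity)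
  obtain ⟨δ, hδ, hΦδ⟩ := hΦ R η hη
  have hint : ∀ i s, Integrable (fun x => g (Φ i (x, s), s)) ν := fun i s => by
    refine Integrable.of_bound (C := B) ?_ (.of_forall fun x => hB _)
    have h1 := hc i
    have h2 := hg.continuous
    exact Continuous.aestronglyMeasurable (by fun_prop)
  refine ⟨min δ η, lt_min hδ hη, fun s e hse i => ?_⟩
  have hlt : ∀ x, ‖g (Φ i (x, s), s) - g (Φ i (x, e), e)‖ ≤ ε / (ν.real univ + 1) := by
    intro x
    have hsη : dist s e < η := hse.trans_le (min_le_right _ _)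
    have hsδ : dist s e < δ := hse.trans_le (min_le_left _ _)
    have key : ‖Φ i (x, s) - Φ i (x, e)‖ < η →
        ‖g (Φ i (x, s), s) - g (Φ i (x, e), e)‖ ≤ ε / (ν.real univ + 1) := fun h => by
      rw [← dist_eq_norm]
      refine (hgη ?_).le
      rw [Prod.dist_eq]
      exact max_lt (by rwa [dist_eq_norm]) hsη
    by_cases h1 : ‖Φ i (x, s)‖ ≤ R
    · refine key ?_
      rw [norm_sub_rev]
      exact hΦδ i x s e (by rwa [← Real.dist_eq, dist_comm]) h1
    by_cases h2 : ‖Φ i (x, e)‖ ≤ R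
    · exact key (hΦδ i x e s (by rwa [← Real.dist_eq]) h2)
    · rw [hR _ _ (not_le.1 h1), hR _ _ (not_le.1 h2)]
      simp only [sub_self, norm_zero]
      positivity
  rw [dist_eq_norm, ← integral_sub (hint i s) (hint i e)]
  calc _ ≤ ε / (ν.real univ + 1) * ν.real univ := norm_integral_le_of_norm_le_const (.of_forall hlt)
    _ < ε := by
      rw [div_mul_eq_mul_div, div_lt_iff₀ hν]
      nlinarith

/-! ### Test functions along trajectories -/

/-- A function on `E × [0, t]` that is continuous and vanishes for large `x` becomes uniformly
continuous and bounded when extended to `E × ℝ` by constants in time. -/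
theorem uniformContinuous_comp_projIcc {E F : Type*} [NormedAddCommGroup E] [NormedSpace ℝ E]
    [ProperSpace E] [NormedAddCommGroup F] {g : E × ℝ → F} {t : ℝ} (ht : 0 ≤ t)
    (hg : ContinuousOn g (univ ×ˢ Icc 0 t)) {R : ℝ}
    (hR : ∀ x, R < ‖x‖ → ∀ s ∈ Icc 0 t, g (x, s) = 0) :
    UniformContinuous (fun p : E × ℝ => g (p.1, projIcc 0 t ht p.2)) ∧
      ∃ B, ∀ p : E × ℝ, ‖g (p.1, projIcc 0 t ht p.2)‖ ≤ B := by
  let G : E × Icc 0 t → F := fun p => g (p.1, p.2)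
  have hGc : Continuous G :=
    hg.comp_continuous (by fun_prop) fun p => ⟨mem_univ _, p.2.2⟩
  have hGs : HasCompactSupport G :=
    HasCompactSupport.intro ((isCompact_closedBall (0 : E) R).prod isCompact_univ) fun p hp => by
      refine hR p.1 (not_le.1 fun h => hp ⟨by simpa using h, mem_univ _⟩) _ p.2.2
  refine ⟨(hGs.uniformContinuous_of_continuous hGc).comp (uniformContinuous_fst.prodMk
    ((LipschitzWith.projIcc ht).uniformContinuous.comp uniformContinuous_snd)), ?_⟩
  obtain ⟨B, hB⟩ := hGs.exists_bound_of_continuous hGc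
  exact ⟨B, fun p => hB (p.1, projIcc 0 t ht p.2)⟩

theorem IsTestFunction.eq_zero_of_lt_norm {d : ℕ} {T : ℝ}
    {u ut : EuclideanSpace ℝ (Fin d) × ℝ → ℝ}
    {ux : EuclideanSpace ℝ (Fin d) × ℝ → EuclideanSpace ℝ (Fin d)}
    (hu : IsTestFunction T u ut ux) :
    ∃ R : ℝ, ∀ x, R < ‖x‖ → ∀ t ∈ Ico (0 : ℝ) T, u (x, t) = 0 ∧ ut (x, t) = 0 ∧ ux (x, t) = 0 := by
  obtain ⟨R, hR⟩ := hu.vanishes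
  refine ⟨R, fun x hx t ht => ⟨hR x hx t ht, ?_, ?_⟩⟩
  · have h1 : HasDerivWithinAt (fun s => u (x, s)) 0 (Ico 0 T) t :=
      (hasDerivWithinAt_const t _ (0 : ℝ)).congr_of_mem (fun s hs => hR x hx s hs) ht
    exact (uniqueDiffOn_Ico 0 T t ht).eq_deriv _ (hu.hasDeriv_time x t ht) h1
  · have h1 : (fun y => u (y, t)) =ᶠ[𝓝 x] fun _ => 0 := by
      filter_upwards [(isOpen_lt continuous_const continuous_norm).mem_nhds hx] with y hy
      exact hR y hy t ht
    rw [← (hu.hasGradient_space x t ht).gradient, h1.gradient_eq, gradient_fun_const]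

theorem IsTestFunction.hasDerivAt_comp {d : ℕ} {T : ℝ}
    {u ut : EuclideanSpace ℝ (Fin d) × ℝ → ℝ}
    {ux : EuclideanSpace ℝ (Fin d) × ℝ → EuclideanSpace ℝ (Fin d)}
    (hu : IsTestFunction T u ut ux) {γ : ℝ → EuclideanSpace ℝ (Fin d)}
    {v : EuclideanSpace ℝ (Fin d)} {t : ℝ} (ht : t ∈ Ioo 0 T) (hγ : HasDerivAt γ v t) :
    HasDerivAt (fun s => u (γ s, s)) (ut (γ t, t) + inner ℝ v (ux (γ t, t))) t := by
  have hopen : (univ ×ˢ Ioo 0 T : Set (EuclideanSpace ℝ (Fin d) × ℝ)) ∈ 𝓝 (γ t, t) :=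
    (isOpen_univ.prod isOpen_Ioo).mem_nhds ⟨mem_univ _, ht⟩
  have hsub : (univ ×ˢ Ioo 0 T : Set (EuclideanSpace ℝ (Fin d) × ℝ)) ⊆ univ ×ˢ Ico 0 T :=
    prod_mono_right Ioo_subset_Ico_self
  -- Continuous partial derivatives near an interior point give joint differentiability, hence the
  -- chain rule.
  have key := hasStrictFDerivAt_uncurry_coprod (𝕜 := ℝ) (u := (γ t, t)) (f := fun x s => u (x, s))
    (f₁ := fun x s => InnerProductSpace.toDual ℝ _ (ux (x, s)))
    (f₂ := fun x s => ContinuousLinearMap.toSpanSingleton ℝ (ut (x, s)))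
    (by
      filter_upwards [hopen] with p hp
      exact (hu.hasGradient_space p.1 p.2 (hsub hp).2).hasFDerivAt)
    (by
      filter_upwards [hopen] with p hp
      exact ((hu.hasDeriv_time p.1 p.2 (hsub hp).2).hasDerivAt
        (Ico_mem_nhds hp.2.1 hp.2.2)).hasFDerivAt)
    ((InnerProductSpace.toDual ℝ _).continuous.continuousAt.comp
      ((hu.continuousOn_space.mono hsub).continuousAt hopen))
    ((ContinuousLinearMap.toSpanSingletonCLE (𝕜 := ℝ)).continuous.continuousAt.comp
      ((hu.continuousOn_time.mono hsub).continuousAt hopen))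
  have h2 : HasDerivAt (fun s => (γ s, s)) (v, (1 : ℝ)) t := hγ.prodMk (hasDerivAt_id t)
  have h3 := key.hasFDerivAt.comp_hasDerivAt (f := fun s => (γ s, s)) t h2
  refine h3.congr_deriv ?_
  simp [Function.HasUncurry.uncurry, real_inner_comm, add_comm]

/-- Test functions along integral curves: the fundamental theorem of calculus. -/
theorem IsTestFunction.comp_sub_comp_eq_integral {d : ℕ} {T : ℝ}
    {u ut : EuclideanSpace ℝ (Fin d) × ℝ → ℝ}
    {ux a : EuclideanSpace ℝ (Fin d) × ℝ → EuclideanSpace ℝ (Fin d)}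
    (hu : IsTestFunction T u ut ux) (ha : Continuous a) {γ : ℝ → EuclideanSpace ℝ (Fin d)}
    (hγc : Continuous γ)
    (hγ : ∀ t ∈ Icc 0 T, HasDerivWithinAt γ (a (γ t, t)) (Icc 0 T) t) {t : ℝ} (ht : t ∈ Ico 0 T) :
    ∫ s in (0 : ℝ)..t, (ut (γ s, s) + inner ℝ (a (γ s, s)) (ux (γ s, s))) =
      u (γ t, t) - u (γ 0, 0) := by
  have hmaps : MapsTo (fun s => (γ s, s)) (Icc 0 t) (univ ×ˢ Ico 0 T) :=
    fun s hs => ⟨mem_univ _, hs.1, hs.2.trans_lt ht.2⟩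
  have hc : Continuous fun s => (γ s, s) := by fun_prop
  -- Only derivatives at interior times are required, so the one-sided derivative at 0 plays no
  -- role.
  refine intervalIntegral.integral_eq_sub_of_hasDerivAt_of_le ht.1
    (f := fun s => u (γ s, s)) (hu.continuousOn.comp hc.continuousOn hmaps)
    (fun s hs => hu.hasDerivAt_comp ⟨hs.1, hs.2.trans ht.2⟩ ?_) ?_
  · exact (hγ s ⟨hs.1.le, hs.2.le.trans ht.2.le⟩).hasDerivAt (Icc_mem_nhds hs.1 (hs.2.trans ht.2))
  · refine ContinuousOn.intervalIntegrable_of_Icc ht.1 ?_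
    exact (hu.continuousOn_time.comp hc.continuousOn hmaps).add
      ((ha.comp hc).continuousOn.inner (hu.continuousOn_space.comp hc.continuousOn hmaps))

theorem IsTestFunction.continuousOn_drift {d : ℕ} {T : ℝ}
    {u ut : EuclideanSpace ℝ (Fin d) × ℝ → ℝ}
    {ux a : EuclideanSpace ℝ (Fin d) × ℝ → EuclideanSpace ℝ (Fin d)}
    (hu : IsTestFunction T u ut ux) (ha : ContinuousOn a (univ ×ˢ Icc 0 T)) {t : ℝ} (ht : t < T) :
    ContinuousOn (fun p => ut p + inner ℝ (a p) (ux p)) (univ ×ˢ Icc 0 t) := by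
  have hsub : (univ ×ˢ Icc 0 t : Set (EuclideanSpace ℝ (Fin d) × ℝ)) ⊆ univ ×ˢ Ico 0 T :=
    prod_mono_right fun s hs => ⟨hs.1, hs.2.trans_lt ht⟩
  exact (hu.continuousOn_time.mono hsub).add ((ha.mono (hsub.trans
    (prod_mono_right Ico_subset_Icc_self))).inner (hu.continuousOn_space.mono hsub))

/-- The fundamental theorem of calculus on each trajectory, integrated over its starting point;
freezing time outside `[0, t]` makes the integrand bounded and continuous, which justifies Fubini.
-/
theorem integral_flow_eq {d : ℕ} {T : ℝ}
    {u ut : EuclideanSpace ℝ (Fin d) × ℝ → ℝ}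
    {ux a Φ : EuclideanSpace ℝ (Fin d) × ℝ → EuclideanSpace ℝ (Fin d)}
    (hu : IsTestFunction T u ut ux) (ha : Continuous a) (hΦc : Continuous Φ)
    (hΦ0 : ∀ x, Φ (x, 0) = x)
    (hΦ : ∀ x, ∀ t ∈ Icc 0 T,
      HasDerivWithinAt (fun s => Φ (x, s)) (a (Φ (x, t), t)) (Icc 0 T) t)
    (ν : Measure (EuclideanSpace ℝ (Fin d))) [IsFiniteMeasure ν] {t : ℝ} (ht : t ∈ Ico 0 T) :
    ∫ x, u (Φ (x, t), t) ∂ν = ∫ x, u (x, 0) ∂ν + ∫ s in (0 : ℝ)..t,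
      ∫ x, (ut (Φ (x, s), s) + inner ℝ (a (Φ (x, s), s)) (ux (Φ (x, s), s))) ∂ν := by
  obtain ⟨R, hR⟩ := hu.eq_zero_of_lt_norm
  have hsub : (univ ×ˢ Icc 0 t : Set (EuclideanSpace ℝ (Fin d) × ℝ)) ⊆ univ ×ˢ Ico 0 T :=
    prod_mono_right fun s hs => ⟨hs.1, hs.2.trans_lt ht.2⟩
  obtain ⟨hguc, B, hB⟩ := uniformContinuous_comp_projIcc ht.1
    (hu.continuousOn_drift ha.continuousOn ht.2) (R := R) (fun x hx s hs => by
      obtain ⟨-, h1, h2⟩ := hR x hx s ⟨hs.1, hs.2.trans_lt ht.2⟩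
      simp [h1, h2])
  obtain ⟨huuc, Bu, hBu⟩ := uniformContinuous_comp_projIcc ht.1
    (hu.continuousOn.mono hsub) (R := R)
    (fun x hx s hs => (hR x hx s ⟨hs.1, hs.2.trans_lt ht.2⟩).1)
  set g := fun p => ut p + inner ℝ (a p) (ux p)
  have hu_int : ∀ s ∈ Icc 0 t, Integrable (fun x => u (Φ (x, s), s)) ν := fun s hs => by
    have h1 : (fun x => u (Φ (x, s), s)) = fun x => u (Φ (x, s), projIcc 0 t ht.1 s) := by
      rw [projIcc_of_mem ht.1 hs]
    rw [h1]
    refine Integrable.of_bound (C := Bu) ?_ (.of_forall fun x => hBu (Φ (x, s), s))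
    exact (huuc.continuous.comp (by fun_prop :
      Continuous fun x => (Φ (x, s), s))).aestronglyMeasurable
  have hcongr : ∀ x, ∫ s in (0 : ℝ)..t, g (Φ (x, s), projIcc 0 t ht.1 s) =
      u (Φ (x, t), t) - u (Φ (x, 0), 0) := fun x => by
    rw [← hu.comp_sub_comp_eq_integral ha (γ := fun s => Φ (x, s)) (by fun_prop) (hΦ x) ht]
    refine intervalIntegral.integral_congr fun s hs => ?_
    rw [uIcc_of_le ht.1] at hs
    simp only [projIcc_of_mem ht.1 hs, g]
  have hswap : ∫ s in (0 : ℝ)..t, ∫ x, g (Φ (x, s), projIcc 0 t ht.1 s) ∂ν =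
      ∫ x, (∫ s in (0 : ℝ)..t, g (Φ (x, s), projIcc 0 t ht.1 s)) ∂ν := by
    refine intervalIntegral_integral_swap ?_
    rw [uIoc_of_le ht.1]
    refine Integrable.of_bound (C := B) ?_ (.of_forall fun p => hB (Φ (p.2, p.1), p.1))
    exact (hguc.continuous.comp (by fun_prop : Continuous fun p : ℝ × EuclideanSpace ℝ (Fin d) =>
      (Φ (p.2, p.1), p.1))).aestronglyMeasurable
  have hcongr' : ∫ s in (0 : ℝ)..t, ∫ x, g (Φ (x, s), s) ∂ν =
      ∫ s in (0 : ℝ)..t, ∫ x, g (Φ (x, s), projIcc 0 t ht.1 s) ∂ν := by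
    refine intervalIntegral.integral_congr fun s hs => ?_
    rw [uIcc_of_le ht.1] at hs
    simp only [projIcc_of_mem ht.1 hs]
  rw [hcongr', hswap]
  simp only [hcongr]
  rw [integral_sub (hu_int t ⟨ht.1, le_rfl⟩) (hu_int 0 ⟨le_rfl, ht.1⟩)]
  simp only [hΦ0, add_sub_cancel]

/-! ### Passage to the limit in the weak equation -/

/-- Pointwise convergence of a uniformly equicontinuous family is uniform on compact intervals. -/
theorem UniformEquicontinuous.tendstoUniformlyOn_Icc {ι : Type*} {F : ι → ℝ → ℝ} {f : ℝ → ℝ}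
    {l : Filter ι} {a b : ℝ} (hF : UniformEquicontinuous F)
    (h : ∀ s ∈ Icc a b, Tendsto (fun i => F i s) l (𝓝 (f s))) :
    TendstoUniformlyOn F f l (Icc a b) := by
  have := (EquicontinuousOn.tendsto_uniformOnFun_iff_pi' (𝔖 := {Icc a b}) (F := F)
    (by simpa using isCompact_Icc)
    (by simpa using hF.equicontinuous.equicontinuousOn _) l f).2 (by
      rw [tendsto_pi_nhds]
      rintro ⟨s, hs⟩
      exact h s (by simpa using hs))
  exact UniformOnFun.tendsto_iff_tendstoUniformlyOn.1 this _ rfl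

theorem TendstoUniformlyOn.tendsto_integral_Icc {ι : Type*} {F : ι → ℝ → ℝ} {f : ℝ → ℝ}
    {l : Filter ι} {a b : ℝ} (hab : a ≤ b) (hF : ∀ i, ContinuousOn (F i) (Icc a b))
    (hf : ContinuousOn f (Icc a b)) (h : TendstoUniformlyOn F f l (Icc a b)) :
    Tendsto (fun i => ∫ s in a..b, F i s) l (𝓝 (∫ s in a..b, f s)) := by
  rw [Metric.tendsto_nhds]
  intro ε hε
  have hpos : 0 < b - a + 1 := by linarith
  filter_upwards [Metric.tendstoUniformlyOn_iff.1 h (ε / (b - a + 1)) (by positivity)] with i hi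
  rw [dist_eq_norm, ← intervalIntegral.integral_sub ((hF i).intervalIntegrable_of_Icc hab)
    (hf.intervalIntegrable_of_Icc hab)]
  refine (intervalIntegral.norm_integral_le_of_norm_le_const (C := ε / (b - a + 1))
    fun s hs => ?_).trans_lt ?_
  · rw [uIoc_of_le hab] at hs
    rw [← dist_eq_norm, dist_comm]
    exact (hi s (Ioc_subset_Icc_self hs)).le
  · rw [abs_of_nonneg (sub_nonneg.2 hab), div_mul_eq_mul_div, div_lt_iff₀ hpos]
    nlinarith

/-- A sequence of fields that are bounded on a set and converge uniformly on it to a bounded field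
is uniformly bounded on it. -/
theorem TendstoUniformlyOn.exists_norm_le {α F : Type*} [SeminormedAddCommGroup F]
    {f : ℕ → α → F} {g : α → F} {s : Set α} (h : TendstoUniformlyOn f g atTop s)
    (hg : ∃ M, ∀ x ∈ s, ‖g x‖ ≤ M) (hf : ∀ n, ∃ M, ∀ x ∈ s, ‖f n x‖ ≤ M) :
    ∃ M, ∀ n, ∀ x ∈ s, ‖f n x‖ ≤ M := by
  obtain ⟨M, hM⟩ := hg
  choose C hC using hf
  obtain ⟨N, hN⟩ := eventually_atTop.1 (Metric.tendstoUniformlyOn_iff.1 h 1 one_pos)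
  refine ⟨∑ n ∈ Finset.range N, |C n| + |M| + 1, fun n x hx => ?_⟩
  have h0 : 0 ≤ ∑ n ∈ Finset.range N, |C n| := Finset.sum_nonneg fun _ _ => abs_nonneg _
  rcases lt_or_ge n N with hn | hn
  · have h1 := Finset.single_le_sum (f := fun n => |C n|) (fun _ _ => abs_nonneg _)
      (Finset.mem_range.2 hn)
    have h2 := (hC n x hx).trans (le_abs_self _)
    have h3 := abs_nonneg M
    linarith
  · have h1 := hN n hn x hx
    rw [dist_eq_norm] at h1
    have h2 := norm_le_norm_add_norm_sub (g x) (f n x)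
    have h3 := (hM x hx).trans (le_abs_self _)
    linarith

/-- Vague limits of the laws of integral curves of `a k` satisfy the weak continuity equation for
the limit field `b`. -/
theorem integral_limit_eq {d : ℕ} {T : ℝ}
    {b : EuclideanSpace ℝ (Fin d) × ℝ → EuclideanSpace ℝ (Fin d)}
    (hb : ContinuousOn b (univ ×ˢ Icc 0 T))
    {a Φ : ℕ → EuclideanSpace ℝ (Fin d) × ℝ → EuclideanSpace ℝ (Fin d)}
    (ha : ∀ k, Continuous (a k)) (hΦc : ∀ k, Continuous (Φ k)) (hΦ0 : ∀ k x, Φ k (x, 0) = x)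
    (hΦ : ∀ k x, ∀ t ∈ Icc 0 T,
      HasDerivWithinAt (fun s => Φ k (x, s)) (a k (Φ k (x, t), t)) (Icc 0 T) t)
    (hmod : ∀ R ε : ℝ, 0 < ε → ∃ δ > 0, ∀ k x s e, |e - s| < δ → ‖Φ k (x, s)‖ ≤ R →
      ‖Φ k (x, e) - Φ k (x, s)‖ < ε)
    (ν : Measure (EuclideanSpace ℝ (Fin d))) [IsFiniteMeasure ν]
    {l : Filter ℕ} [l.NeBot]
    (hab : ∀ R : ℝ, TendstoUniformlyOn a b l (Metric.closedBall 0 R ×ˢ Icc 0 T))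
    {μ : ℝ → Measure (EuclideanSpace ℝ (Fin d))}
    (hμ : ∀ t, ∀ f : EuclideanSpace ℝ (Fin d) → ℝ, Continuous f → HasCompactSupport f →
      Tendsto (fun k => ∫ x, f (Φ k (x, t)) ∂ν) l (𝓝 (∫ x, f x ∂(μ t))))
    {u ut : EuclideanSpace ℝ (Fin d) × ℝ → ℝ}
    {ux : EuclideanSpace ℝ (Fin d) × ℝ → EuclideanSpace ℝ (Fin d)}
    (hu : IsTestFunction T u ut ux) {t : ℝ} (ht : t ∈ Ico 0 T) :
    ∫ x, u (x, t) ∂(μ t) = ∫ x, u (x, 0) ∂ν +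
      ∫ s in (0 : ℝ)..t, ∫ x, (ut (x, s) + inner ℝ (b (x, s)) (ux (x, s))) ∂(μ s) := by
  obtain ⟨R, hR⟩ := hu.eq_zero_of_lt_norm
  have hmem : ∀ s ∈ Icc 0 t, s ∈ Ico 0 T := fun s hs => ⟨hs.1, hs.2.trans_lt ht.2⟩
  have hsub : (univ ×ˢ Icc 0 t : Set (EuclideanSpace ℝ (Fin d) × ℝ)) ⊆ univ ×ˢ Ico 0 T :=
    prod_mono_right hmem
  -- uniform continuity of the drifts, extended by constants in time
  have hcutoff : ∀ a : EuclideanSpace ℝ (Fin d) × ℝ → EuclideanSpace ℝ (Fin d),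
      ContinuousOn a (univ ×ˢ Icc 0 T) →
      UniformEquicontinuous (fun i s => ∫ x, (ut (Φ i (x, s), projIcc 0 t ht.1 s) +
        inner ℝ (a (Φ i (x, s), projIcc 0 t ht.1 s)) (ux (Φ i (x, s), projIcc 0 t ht.1 s))) ∂ν) ∧
      ∀ k, ∀ s ∈ Icc 0 t, Integrable (fun x => ut (Φ k (x, s), s) +
        inner ℝ (a (Φ k (x, s), s)) (ux (Φ k (x, s), s))) ν := by
    intro a ha
    have hzero : ∀ x, R < ‖x‖ → ∀ s ∈ Icc 0 t, ut (x, s) + inner ℝ (a (x, s)) (ux (x, s)) = 0 := by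
      intro x hx s hs
      obtain ⟨-, h1, h2⟩ := hR x hx s (hmem s hs)
      simp [h1, h2]
    obtain ⟨h1, B, h2⟩ := uniformContinuous_comp_projIcc ht.1 (hu.continuousOn_drift ha ht.2) hzero
    refine ⟨uniformEquicontinuous_integral_flow hΦc hmod ν h1 h2 (R := R)
      fun x s hx => hzero x hx _ (projIcc 0 t ht.1 s).2, fun k s hs => ?_⟩
    have h3 := hΦc k
    have h4 : Integrable (fun x => (fun p : EuclideanSpace ℝ (Fin d) × ℝ =>
        ut (p.1, projIcc 0 t ht.1 p.2) + inner ℝ (a (p.1, projIcc 0 t ht.1 p.2))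
          (ux (p.1, projIcc 0 t ht.1 p.2))) (Φ k (x, s), s)) ν :=
      Integrable.of_bound (C := B) (h1.continuous.comp (by fun_prop :
        Continuous fun x => (Φ k (x, s), s))).aestronglyMeasurable (.of_forall fun x => h2 _)
    simpa only [projIcc_of_mem ht.1 hs] using h4
  -- `A` is the true drift of the approximation, `D` has the limit field along the same
  -- trajectories, `L` is the limit: `D → L` by equicontinuity, `A - D → 0` by convergence of the
  -- fields.
  set A : ℕ → ℝ → ℝ := fun k s => ∫ x, (ut (Φ k (x, s), s) +
        inner ℝ (a k (Φ k (x, s), s)) (ux (Φ k (x, s), s))) ∂ν with hA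
  set D : ℕ → ℝ → ℝ := fun k s => ∫ x, (ut (Φ k (x, s), s) +
        inner ℝ (b (Φ k (x, s), s)) (ux (Φ k (x, s), s))) ∂ν with hD
  set L : ℝ → ℝ := fun s => ∫ x, (ut (x, s) + inner ℝ (b (x, s)) (ux (x, s))) ∂(μ s) with hL
  have hAc : ∀ k, ContinuousOn (A k) (Icc 0 t) := fun k => by
    refine (((hcutoff (a k) (ha k).continuousOn).1.equicontinuous.continuous k).continuousOn).congr
      fun s hs => ?_
    simp only [hA, projIcc_of_mem ht.1 hs]
  have hDc : ∀ k, ContinuousOn (D k) (Icc 0 t) := fun k => by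
    refine (((hcutoff b hb).1.equicontinuous.continuous k).continuousOn).congr fun s hs => ?_
    simp only [hD, projIcc_of_mem ht.1 hs]
  have hslice : ∀ {g : EuclideanSpace ℝ (Fin d) × ℝ → ℝ}, ContinuousOn g (univ ×ˢ Icc 0 t) →
      (∀ x, R < ‖x‖ → ∀ s ∈ Icc 0 t, g (x, s) = 0) → ∀ s ∈ Icc 0 t,
      Tendsto (fun k => ∫ x, g (Φ k (x, s), s) ∂ν) l (𝓝 (∫ x, g (x, s) ∂(μ s))) := by
    intro g hg hzero s hs
    refine hμ s (fun x => g (x, s)) (hg.comp_continuous (by fun_prop) fun x => ⟨mem_univ _, hs⟩) ?_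
    exact HasCompactSupport.intro (isCompact_closedBall 0 R) fun x hx =>
      hzero x (by simpa using hx) s hs
  have hDL : TendstoUniformlyOn D L l (Icc 0 t) := by
    refine ((hcutoff b hb).1.tendstoUniformlyOn_Icc (f := L) (l := l) fun s hs => ?_).congr
      (.of_forall fun k s hs => ?_)
    · simp only [projIcc_of_mem ht.1 hs]
      refine hslice (hu.continuousOn_drift hb ht.2) (fun x hx s hs => ?_) s hs
      obtain ⟨-, h1, h2⟩ := hR x hx s (hmem s hs)
      simp [h1, h2]
    · simp only [hD, projIcc_of_mem ht.1 hs]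
  have hLc : ContinuousOn L (Icc 0 t) := hDL.continuousOn (.of_forall hDc)
  have hAL : TendstoUniformlyOn A L l (Icc 0 t) := by
    obtain ⟨-, B, hB⟩ := uniformContinuous_comp_projIcc ht.1 (hu.continuousOn_space.mono hsub)
      (R := R) fun x hx s hs => (hR x hx s (hmem s hs)).2.2
    have hB0 : 0 ≤ B := (norm_nonneg _).trans (hB 0)
    rw [Metric.tendstoUniformlyOn_iff] at hDL ⊢
    intro ε hε
    have hpos : 0 < B * ν.real univ + 1 := by positivity
    filter_upwards [hDL (ε / 2) (by positivity), Metric.tendstoUniformlyOn_iff.1 (hab R)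
      (ε / 2 / (B * ν.real univ + 1)) (by positivity)] with k hk1 hk2 s hs
    have h1 : dist (D k s) (A k s) ≤ ε / 2 / (B * ν.real univ + 1) * B * ν.real univ := by
      rw [dist_eq_norm]
      simp only [hD, hA]
      rw [← integral_sub ((hcutoff b hb).2 k s hs) ((hcutoff _ (ha k).continuousOn).2 k s hs)]
      refine norm_integral_le_of_norm_le_const (.of_forall fun x => ?_)
      rw [add_sub_add_left_eq_sub, ← inner_sub_left]
      by_cases hx : ‖Φ k (x, s)‖ ≤ R
      · refine (norm_inner_le_norm _ _).trans ?_
        have h2 := hk2 (Φ k (x, s), s) ⟨by simpa using hx, hs.1, hs.2.trans ht.2.le⟩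
        rw [dist_eq_norm] at h2
        have h3 := hB (Φ k (x, s), s)
        simp only [projIcc_of_mem ht.1 hs] at h3
        gcongr
      · rw [(hR _ (not_le.1 hx) s (hmem s hs)).2.2, inner_zero_right, norm_zero]
        positivity
    have h2 : ε / 2 / (B * ν.real univ + 1) * B * ν.real univ ≤ ε / 2 := by
      rw [mul_assoc, div_mul_eq_mul_div, div_le_iff₀ hpos]
      nlinarith
    have h3 := hk1 s hs
    have h4 := dist_triangle (L s) (D k s) (A k s)
    linarith
  have hlim1 := hslice (hu.continuousOn.mono hsub) (fun x hx s hs => (hR x hx s (hmem s hs)).1)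
    t ⟨ht.1, le_rfl⟩
  have hlim2 := (hAL.tendsto_integral_Icc ht.1 hAc hLc).const_add (∫ x, u (x, 0) ∂ν)
  refine tendsto_nhds_unique hlim1 (hlim2.congr fun k => ?_)
  exact (integral_flow_eq hu (ha k) (hΦc k) (hΦ0 k) (hΦ k) ν ht).symm

/-! ### Space-time measure, cut-offs and the Lyapunov bound -/

/-- A measurable family of measures of uniformly bounded mass gives a finite measure on the
strip. -/
theorem exists_isGivenByFamily {d : ℕ} (T : ℝ) {μ : ℝ → Measure (EuclideanSpace ℝ (Fin d))}
    (hμ : Measurable μ) {C : ℝ≥0} (hC : ∀ t, μ t univ ≤ C) :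
    ∃ M : Measure (EuclideanSpace ℝ (Fin d) × ℝ), IsFiniteMeasure M ∧ IsGivenByFamily T M μ := by
  let κ : ProbabilityTheory.Kernel ℝ (EuclideanSpace ℝ (Fin d)) := ⟨μ, hμ⟩
  have hκ : ProbabilityTheory.IsFiniteKernel κ := ⟨C, ENNReal.coe_lt_top, hC⟩
  let M := ((volume.restrict (Icc 0 T)).compProd κ).map Prod.swap
  have hM : IsFiniteMeasure M := by infer_instance
  refine ⟨M, hM, ?_, fun K _ => measure_lt_top M K,
    fun t _ K _ => (measure_mono (subset_univ K)).trans_lt ((hC t).trans_lt ENNReal.coe_lt_top),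
    fun B hB _ => ((Measure.measurable_coe hB).comp hμ).comp measurable_subtype_coe,
    fun K _ => ?_, fun u hu huc _ => ?_⟩
  · have hS : MeasurableSet ((univ ×ˢ Icc 0 T : Set (EuclideanSpace ℝ (Fin d) × ℝ))ᶜ) :=
      (MeasurableSet.univ.prod measurableSet_Icc).compl
    rw [Measure.map_apply measurable_swap hS, Measure.compProd_apply (measurable_swap hS)]
    refine (setLIntegral_congr_fun (g := fun _ => 0) measurableSet_Icc fun t ht => ?_).trans
      (by simp)
    have : Prod.mk t ⁻¹' (Prod.swap ⁻¹' (univ ×ˢ Icc 0 T : Set (EuclideanSpace ℝ (Fin d) × ℝ))ᶜ) =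
        ∅ := by
      ext x
      simp [ht.1, ht.2]
    simp only [this, measure_empty]
  · calc ∫⁻ t in Icc 0 T, μ t K ≤ ∫⁻ _ in Icc 0 T, C :=
          lintegral_mono fun t => (measure_mono (subset_univ K)).trans (hC t)
      _ < ⊤ := by
        rw [setLIntegral_const]
        exact ENNReal.mul_lt_top ENNReal.coe_lt_top (by simp)
  · have hi : Integrable u M := hu.continuous.integrable_of_hasCompactSupport huc
    rw [integral_map measurable_swap.aemeasurable hi.aestronglyMeasurable]
    exact Measure.integral_compProd (hi.comp_measurable measurable_swap)

/-- Cutting off a sequence of smooth fields. -/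
theorem exists_cutoff_field {E : Type*} [NormedAddCommGroup E] [NormedSpace ℝ E]
    [FiniteDimensional ℝ E] (T : ℝ) (bk : ℕ → E × ℝ → E) (hbk : ∀ k, ContDiff ℝ ∞ (bk k)) :
    ∃ χ : ℕ → E × ℝ → ℝ, (∀ k p, χ k p ∈ Icc 0 1) ∧
      (∀ k, ContDiff ℝ 1 fun p => χ k p • bk k p) ∧
      (∀ k, HasCompactSupport fun p => χ k p • bk k p) ∧
      ∀ R : ℝ, ∀ᶠ k in atTop, ∀ p ∈ Metric.closedBall (0 : E) R ×ˢ Icc 0 T, χ k p = 1 := by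
  let χ : (k : ℕ) → ContDiffBump (0 : E × ℝ) := fun k =>
    -- The product carries the maximum norm, so this inner radius covers the times `[0, T]` and the
    -- balls of radius at most `k`.
    ⟨|T| + k + 1, |T| + k + 2, by positivity, by linarith⟩
  refine ⟨fun k => χ k, fun k p => ⟨(χ k).nonneg, (χ k).le_one⟩,
    fun k => ((χ k).contDiff.smul (hbk k)).of_le (by simp),
    fun k => (χ k).hasCompactSupport.smul_right,
    fun R => ?_⟩
  obtain ⟨N, hN⟩ := exists_nat_ge R
  filter_upwards [eventually_ge_atTop N] with k hk p hp
  refine (χ k).one_of_mem_closedBall ?_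
  have hk' : (N : ℝ) ≤ k := by exact_mod_cast hk
  have hT := abs_nonneg T
  have hk0 : (0 : ℝ) ≤ k := k.cast_nonneg
  rw [mem_closedBall_zero_iff, Prod.norm_def]
  refine max_le ?_ ?_
  · have := mem_closedBall_zero_iff.1 hp.1
    simp only [χ]
    linarith
  · rw [Real.norm_eq_abs, abs_of_nonneg hp.2.1]
    have := hp.2.2.trans (le_abs_self T)
    simp only [χ]
    linarith

/-- The cut-off multiplies the derivative of `V` along the curve by a factor in `[0, 1]`. An upper
bound survives this if it is nonnegative, hence `|C|` in place of `C`. -/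
theorem lyapunov_flow_le {E : Type*} [NormedAddCommGroup E] [InnerProductSpace ℝ E]
    [CompleteSpace E] {T C : ℝ} {V : E → ℝ} (hV : ContDiff ℝ 1 V) (hVpos : ∀ x, 0 < V x)
    {c : E × ℝ → ℝ} (hc : ∀ p, c p ∈ Icc (0 : ℝ) 1) {b : E × ℝ → E}
    (hb : ∀ x, ∀ t ∈ Icc (0 : ℝ) T, inner ℝ (b (x, t)) (gradient V x) ≤ C * V x)
    {γ : ℝ → E}
    (hγ : ∀ t ∈ Icc 0 T, HasDerivWithinAt γ (c (γ t, t) • b (γ t, t)) (Icc 0 T) t)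
    {t : ℝ} (ht : t ∈ Icc 0 T) : V (γ t) ≤ Real.exp (|C| * T) * V (γ 0) := by
  have hd : ∀ s ∈ Icc 0 T, HasDerivWithinAt (fun s => V (γ s))
      (inner ℝ (c (γ s, s) • b (γ s, s)) (gradient V (γ s))) (Icc 0 T) s := fun s hs => by
    have h1 := ((hV.differentiable one_ne_zero) (γ s)).hasGradientAt.hasFDerivAt
    have h2 := h1.comp_hasDerivWithinAt s (hγ s hs)
    refine h2.congr_deriv ?_
    rw [InnerProductSpace.toDual_apply_apply, real_inner_comm]
  refine (le_exp_mul_of_hasDerivWithinAt (C := |C|) hd (fun s hs => ?_) ht).trans ?_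
  · rw [real_inner_smul_left]
    have h1 := hb (γ s) s hs
    have h2 := mul_le_mul_of_nonneg_right (le_abs_self C) (hVpos (γ s)).le
    have h3 := hc (γ s, s)
    have h4 : 0 ≤ |C| * V (γ s) := mul_nonneg (abs_nonneg C) (hVpos _).le
    calc _ ≤ c (γ s, s) * (|C| * V (γ s)) := mul_le_mul_of_nonneg_left (h1.trans h2) h3.1
      _ ≤ _ := mul_le_of_le_one_left h4 h3.2
  · have := (hVpos (γ 0)).le
    have := ht.2
    gcongr

/-- Integrals against vague limits are continuous in time. -/
theorem continuous_integral_of_flow_modulus {E : Type*} [NormedAddCommGroup E]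
    [MeasurableSpace E] [BorelSpace E] [SecondCountableTopology E] {ι : Type*} {Φ : ι → E × ℝ → E}
    (hc : ∀ i, Continuous (Φ i))
    (hΦ : ∀ R ε : ℝ, 0 < ε → ∃ δ > 0, ∀ i x s e, |e - s| < δ → ‖Φ i (x, s)‖ ≤ R →
      ‖Φ i (x, e) - Φ i (x, s)‖ < ε)
    (ν : Measure E) [IsFiniteMeasure ν] {l : Filter ι} [l.NeBot] {μ : ℝ → Measure E}
    {f : E → ℝ} (hf : Continuous f) (hfs : HasCompactSupport f)
    (hμ : ∀ t, Tendsto (fun k => ∫ x, f (Φ k (x, t)) ∂ν) l (𝓝 (∫ x, f x ∂(μ t)))) :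
    Continuous fun t => ∫ x, f x ∂(μ t) := by
  obtain ⟨B, hB⟩ := hfs.exists_bound_of_continuous hf
  obtain ⟨R, hR⟩ := hfs.isCompact.isBounded.subset_closedBall (0 : E)
  have := uniformEquicontinuous_integral_flow hc hΦ ν (g := fun p => f p.1)
    ((hfs.uniformContinuous_of_continuous hf).comp uniformContinuous_fst) (fun p => hB p.1)
    (R := R) (fun x t hx => image_eq_zero_of_notMem_tsupport fun h =>
      hx.not_ge (mem_closedBall_zero_iff.1 (hR h)))
  exact (tendsto_pi_nhds.2 hμ).continuous_of_equicontinuous this.equicontinuous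

theorem integral_le_of_eLpNorm_one_le {α : Type*} [MeasurableSpace α] {ν : Measure α}
    {f : α → ℝ} (hf : ∀ x, 0 ≤ f x) (hfm : AEStronglyMeasurable f ν) {S : ℝ≥0∞} (hS : S ≠ ⊤)
    (h : eLpNorm f 1 ν ≤ S) : Integrable f ν ∧ ∫ x, f x ∂ν ≤ S.toReal := by
  have hi : Integrable f ν := memLp_one_iff_integrable.1 ⟨hfm, h.trans_lt hS.lt_top⟩
  refine ⟨hi, ?_⟩
  have h1 := ofReal_integral_norm_eq_lintegral_enorm hi
  rw [← eLpNorm_one_eq_lintegral_enorm] at h1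
  simp only [Real.norm_eq_abs, abs_of_nonneg (hf _)] at h1
  rw [← ENNReal.ofReal_le_iff_le_toReal hS, h1]
  exact h

/-! ### Assembly of the solution -/

theorem proposition1 (d : ℕ) (T : ℝ) (hT : 0 < T)
    (b : EuclideanSpace ℝ (Fin d) × ℝ → EuclideanSpace ℝ (Fin d))
    (hb : ContinuousOn b (univ ×ˢ Icc 0 T))
    (bk : ℕ → EuclideanSpace ℝ (Fin d) × ℝ → EuclideanSpace ℝ (Fin d))
    (hbk : ∀ k, ContDiff ℝ ∞ (bk k))
    (V : ℕ → EuclideanSpace ℝ (Fin d) → ℝ)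
    (hV : ∀ k, ContDiff ℝ 1 (V k))
    (hVpos : ∀ k x, 0 < V k x)
    (C₁ C₂ C₃ : ℝ)
    (hVmono : ∀ k m, k ≤ m → ∀ x, V k x ≤ C₁ * V m x + C₂)
    (hLyap : ∀ k x, ∀ t ∈ Icc (0 : ℝ) T, inner ℝ (bk k (x, t)) (gradient (V k) x) ≤ C₃ * V k x)
    (hgrowth : ∀ k, ∃ C : ℝ, ∀ x, ∀ t ∈ Icc (0 : ℝ) T, (1 + ‖x‖)⁻¹ * ‖bk k (x, t)‖ ≤ C)
    (hconv : ∀ (c : EuclideanSpace ℝ (Fin d)) (r : ℝ),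
      TendstoUniformlyOn bk b atTop (Metric.ball c r ×ˢ Icc 0 T))
    (ν : Measure (EuclideanSpace ℝ (Fin d))) [IsFiniteMeasure ν]
    (hν : (⨆ k, eLpNorm (V k) 1 ν) < ⊤) :
    ∃ μ : ℝ → Measure (EuclideanSpace ℝ (Fin d)),
      (∀ t ∈ Icc (0 : ℝ) T, IsFiniteMeasure (μ t)) ∧
      IsSolution T b ν μ ∧
      ∀ (c : EuclideanSpace ℝ (Fin d)) (r : ℝ),
        Tendsto (fun k => ∫⁻ t in Icc (0 : ℝ) T, ∫⁻ x in Metric.ball c r,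
          ENNReal.ofReal (‖b (x, t) - bk k (x, t)‖ * √(V k x)) ∂(μ t)) atTop (𝓝 0) := by
  have hT0 := hT.le
  obtain ⟨χ, hχ01, hχs, hχc, hχ1⟩ := exists_cutoff_field T bk hbk
  choose Φ hΦc hΦ0 hΦp hΦ using fun k => exists_flow (hχs k) (hχc k) hT0
  set a : ℕ → EuclideanSpace ℝ (Fin d) × ℝ → EuclideanSpace ℝ (Fin d) :=
    fun k p => χ k p • bk k p with ha
  have hbunif : ∀ R : ℝ, TendstoUniformlyOn bk b atTop (Metric.closedBall 0 R ×ˢ Icc 0 T) :=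
    fun R => (hconv 0 (R + 1)).mono
      (prod_mono_left (Metric.closedBall_subset_ball (by linarith)))
  have haunif : ∀ R : ℝ, TendstoUniformlyOn a b atTop (Metric.closedBall 0 R ×ˢ Icc 0 T) := by
    refine fun R => (hbunif R).congr ?_
    filter_upwards [hχ1 R] with k hk p hp
    simp [ha, hk p hp]
  have habound : ∀ R : ℝ, ∃ M : ℝ, ∀ k x, ‖x‖ ≤ R → ∀ t ∈ Icc 0 T, ‖a k (x, t)‖ ≤ M := by
    intro R
    have hK : IsCompact (Metric.closedBall (0 : EuclideanSpace ℝ (Fin d)) R ×ˢ Icc 0 T) :=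
      (isCompact_closedBall 0 R).prod isCompact_Icc
    obtain ⟨M, hM⟩ := (haunif R).exists_norm_le
      (hK.exists_bound_of_continuousOn (hb.mono (prod_mono_left (subset_univ _))))
      fun k => hK.exists_bound_of_continuousOn (hχs k).continuous.continuousOn
    exact ⟨M, fun k x hx t ht => hM k (x, t) ⟨mem_closedBall_zero_iff.2 hx, ht⟩⟩
  have hmod : ∀ R ε : ℝ, 0 < ε → ∃ δ > 0, ∀ k x s e, |e - s| < δ → ‖Φ k (x, s)‖ ≤ R →
      ‖Φ k (x, e) - Φ k (x, s)‖ < ε :=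
    fun R ε hε => exists_flow_modulus hT0 hΦp hΦ habound R hε
  -- the vague limit of the laws
  let l : Ultrafilter ℕ := hyperfilter ℕ
  have hl : (l : Filter ℕ) ≤ atTop := Nat.hyperfilter_le_atTop
  have hΦm : ∀ k t, Measurable fun x => Φ k (x, t) := fun k t => by
    have := hΦc k
    exact Continuous.measurable (by fun_prop)
  have hνC : ν univ = ((ν univ).toNNReal : ℝ≥0∞) := (ENNReal.coe_toNNReal (measure_ne_top ν _)).symm
  have hex : ∀ t, ∃ μ : Measure (EuclideanSpace ℝ (Fin d)), μ univ ≤ (ν univ).toNNReal ∧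
      ∀ f : C_c(EuclideanSpace ℝ (Fin d), ℝ),
        Tendsto (fun k => ∫ x, f x ∂(ν.map fun x => Φ k (x, t))) l (𝓝 (∫ x, f x ∂μ)) := by
    refine fun t => exists_measure_tendsto_integral l (fun k => ν.map fun x => Φ k (x, t))
      fun k => ?_
    rw [Measure.map_apply (hΦm k t) MeasurableSet.univ, preimage_univ, ← hνC]
  choose μ hμC hμ using hex
  have hμlim : ∀ t, ∀ f : EuclideanSpace ℝ (Fin d) → ℝ, Continuous f → HasCompactSupport f →
      Tendsto (fun k => ∫ x, f (Φ k (x, t)) ∂ν) l (𝓝 (∫ x, f x ∂(μ t))) := by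
    intro t f hf hfs
    refine (hμ t ⟨⟨f, hf⟩, hfs⟩).congr fun k => ?_
    exact integral_map (hΦm k t).aemeasurable hf.aestronglyMeasurable
  have hμfin : ∀ t, IsFiniteMeasure (μ t) := fun t => ⟨(hμC t).trans_lt ENNReal.coe_lt_top⟩
  have hμmeas : Measurable μ := measurable_measure_of_integral fun f hf hfs =>
    (continuous_integral_of_flow_modulus hΦc hmod ν hf hfs fun t => hμlim t f hf hfs).measurable
  refine ⟨μ, fun t _ => hμfin t, ?_, fun c r => ?_⟩
  · obtain ⟨M, hMfin, hM⟩ := exists_isGivenByFamily T hμmeas hμC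
    refine ⟨M, hM, fun c r => ?_, fun u ut ux hu => ?_⟩
    · exact ((hb.mono (prod_mono_left (subset_univ _))).integrableOn_compact
        ((isCompact_closedBall c r).prod isCompact_Icc)).mono_set
          (prod_mono_left Metric.ball_subset_closedBall)
    · rw [ae_restrict_iff' measurableSet_Icc]
      -- Test functions are controlled only on `[0, T)`; the endpoint is a null set.
      have hne : ∀ᵐ t : ℝ, t ≠ T := by simp [ae_iff, measure_singleton]
      filter_upwards [hne] with t htT ht
      exact integral_limit_eq hb (fun k => (hχs k).continuous) hΦc hΦ0 hΦ hmod ν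
        (fun R p hp => hl (haunif R p hp)) hμlim hu ⟨ht.1, ht.2.lt_of_ne htT⟩
  -- the Lyapunov bound
  obtain ⟨S, hS⟩ : ∃ S : ℝ, ∀ k, Integrable (V k) ν ∧ ∫ x, V k x ∂ν ≤ S :=
    ⟨_, fun k => integral_le_of_eLpNorm_one_le (fun x => (hVpos k x).le)
      (hV k).continuous.aestronglyMeasurable hν.ne (le_iSup (fun k => eLpNorm (V k) 1 ν) k)⟩
  have hS0 : 0 ≤ S := (integral_nonneg fun x => (hVpos 0 x).le).trans (hS 0).2
  set e := Real.exp (|C₃| * T)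
  set C := (1 + |C₂|) * ν.real univ + |C₁| * e * S with hC
  have hC0 : 0 ≤ C := by positivity
  have hbound : ∀ n, ∀ t ∈ Icc 0 T, ∀ f : EuclideanSpace ℝ (Fin d) → ℝ, Continuous f →
      HasCompactSupport f → (∀ x, 0 ≤ f x) → (∀ x, f x ≤ √(V n x)) → ∫ x, f x ∂(μ t) ≤ C := by
    intro n t ht f hf hfs hf0 hfV
    -- Here `n` is fixed and only `k ≥ n` goes to infinity, so `V n` is estimated through `V k`, the
    -- function adapted to the flow `Φ k`.
    refine le_of_tendsto (hμlim t f hf hfs) (hl ?_)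
    filter_upwards [eventually_ge_atTop n] with k hk
    have hi : Integrable (fun x => 1 + |C₂| + |C₁| * e * V k x) ν :=
      (integrable_const _).add ((hS k).1.const_mul _)
    calc ∫ x, f (Φ k (x, t)) ∂ν ≤ ∫ x, (1 + |C₂| + |C₁| * e * V k x) ∂ν := by
          refine integral_mono_of_nonneg (.of_forall fun x => hf0 _) hi (.of_forall fun x => ?_)
          have h1 := hfV (Φ k (x, t))
          have h2 : √(V n (Φ k (x, t))) ≤ 1 + V n (Φ k (x, t)) := by
            refine (Real.sqrt_le_iff.2 ⟨?_, ?_⟩) <;> nlinarith [hVpos n (Φ k (x, t))]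
          have h3 := hVmono n k hk (Φ k (x, t))
          have h4 := lyapunov_flow_le (γ := fun s => Φ k (x, s)) (hV k) (hVpos k) (hχ01 k)
            (hLyap k) (hΦ k x) ht
          simp only [hΦ0] at h4
          have h5 : C₁ * V k (Φ k (x, t)) ≤ |C₁| * (e * V k x) :=
            (mul_le_mul_of_nonneg_right (le_abs_self _) (hVpos _ _).le).trans
              (mul_le_mul_of_nonneg_left h4 (abs_nonneg _))
          have h6 := le_abs_self C₂
          change f (Φ k (x, t)) ≤ 1 + |C₂| + |C₁| * e * V k x
          linarith
      _ = (1 + |C₂|) * ν.real univ + |C₁| * e * ∫ x, V k x ∂ν := by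
          rw [integral_add (integrable_const _) ((hS k).1.const_mul _), integral_const,
            integral_const_mul, smul_eq_mul, mul_comm (ν.real univ)]
      _ ≤ C := by
          rw [hC]
          have := (hS k).2
          gcongr
  -- Vague limits see only compactly supported functions, so `√(V k)` is cut off by `ψ`, equal to 1
  -- on the ball.
  obtain ⟨ψ, hψ1, -, hψc, hψ01⟩ := exists_continuous_one_zero_of_isCompact
    (isCompact_closedBall c r) isClosed_empty (disjoint_empty _)
  have hfinal : ∀ ε : ℝ, 0 < ε → ∀ᶠ k in atTop, ∫⁻ t in Icc (0 : ℝ) T, ∫⁻ x in Metric.ball c r,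
      ENNReal.ofReal (‖b (x, t) - bk k (x, t)‖ * √(V k x)) ∂(μ t) ≤ ENNReal.ofReal (ε * C * T) := by
    intro ε hε
    filter_upwards [Metric.tendstoUniformlyOn_iff.1 (hconv c r) ε hε] with k hk
    have hslice : ∀ t ∈ Icc 0 T, ∫⁻ x in Metric.ball c r,
        ENNReal.ofReal (‖b (x, t) - bk k (x, t)‖ * √(V k x)) ∂(μ t) ≤ ENNReal.ofReal (ε * C) := by
      intro t ht
      have hfc : Continuous fun x => ψ x * √(V k x) := by
        have := (hV k).continuous
        fun_prop
      have hfs : HasCompactSupport fun x => ψ x * √(V k x) := hψc.mul_right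
      have hf0 : ∀ x, 0 ≤ ψ x * √(V k x) := fun x => mul_nonneg (hψ01 x).1 (Real.sqrt_nonneg _)
      calc _ ≤ ∫⁻ x in Metric.ball c r, ENNReal.ofReal (ε * (ψ x * √(V k x))) ∂(μ t) := by
            refine setLIntegral_mono' Metric.isOpen_ball.measurableSet fun x hx => ?_
            have h1 := hk (x, t) ⟨hx, ht⟩
            rw [dist_eq_norm] at h1
            rw [hψ1 (Metric.ball_subset_closedBall hx), Pi.one_apply, one_mul]
            gcongr
        _ ≤ ∫⁻ x, ENNReal.ofReal (ε * (ψ x * √(V k x))) ∂(μ t) := setLIntegral_le_lintegral _ _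
        _ = ENNReal.ofReal (∫ x, ε * (ψ x * √(V k x)) ∂(μ t)) :=
            (ofReal_integral_eq_lintegral_ofReal
              ((hfc.integrable_of_hasCompactSupport hfs).const_mul ε)
              (.of_forall fun x => mul_nonneg hε.le (hf0 x))).symm
        _ ≤ ENNReal.ofReal (ε * C) := by
            rw [integral_const_mul]
            have := hbound k t ht _ hfc hfs hf0
              fun x => mul_le_of_le_one_left (Real.sqrt_nonneg _) (hψ01 x).2
            gcongr
    calc _ ≤ ∫⁻ _ in Icc (0 : ℝ) T, ENNReal.ofReal (ε * C) :=
          setLIntegral_mono' measurableSet_Icc hslice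
      _ = ENNReal.ofReal (ε * C * T) := by
          rw [setLIntegral_const, Real.volume_Icc, sub_zero, ← ENNReal.ofReal_mul (by positivity)]
  rw [ENNReal.tendsto_nhds_zero]
  intro δ hδ
  obtain ⟨η, hη0, hηδ⟩ := ENNReal.lt_iff_exists_nnreal_btwn.1 hδ
  have hη : (0 : ℝ) < η := by exact_mod_cast hη0
  -- `C` may be zero, so the added 1 keeps the divisor positive.
  have hCT : 0 < C * T + 1 := by positivity
  filter_upwards [hfinal (η / (C * T + 1)) (by positivity)] with k hk
  refine hk.trans (le_trans ?_ hηδ.le)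
  rw [← ENNReal.ofReal_coe_nnreal]
  refine ENNReal.ofReal_le_ofReal ?_
  rw [mul_assoc, div_mul_eq_mul_div, div_le_iff₀ hCT]
  nlinarith
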